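/- Let $J\subseteq\mathbb R$ be a nonempty open interval, $a:J\to(0,\infty)$ a smooth function, and $(S,h)$ a smooth three-dimensional Riemannian manifold of constant sectional curvature $k\in\mathbb R$. Consider the four-dimensional FLRW spacetime $M=J\times S$, $g=-dt^2+a(t)^2h$, with comoving unit timelike vector field $u=\partial_t$ and with $u^\flat = g(u,\cdot)$. For a timelike plane $T\subset T_qM$, spanned by $v,e$ with $g(v,v)=-1$, $g(e,e)=1$, $g(v,e)=0$, let $K(T)=-g(R(v,e)e,v)$ be its sectional curvature, where $R(X,Y)Z=\nabla_X\nabla_YZ-\nabla_Y\nabla_XZ-\nabla_{[X,Y]}Z$, and let $\mathrm{Ric}(Y,Z)=\operatorname{tr}\big(X\mapsto R(X,Y)Z\big)$ and let $\mathrm{Scal}$ be the $g$-trace of $\mathrm{Ric}$. The strong energy condition is: $\mathrm{Ric}(X,X)\ge 0$ for every timelike vector $X$. Then there are functions $\rho,p:M\to\mathbb R$ such that the Einstein equations for a perfect fluid hold: $$\mathrm{Ric}-\tfrac12 \mathrm{Scal}\,g=8\pi\big[(\rho+p)\,u^\flat\otimes u^\flat+p\,g\big],\qquad(*)$$ and $K(T)\le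 0$ for all timelike planes $T$ (at all points of $M$) if and only if the strong energy condition holds. Moreover, for all functions $\rho,p:M\to\mathbb R$ that satisfy $(*)$: 1. $K(T)\le 0$ for all timelike planes $T$ if and only if $\rho+p\ge 0$ and $\rho+3p\ge 0$ everywhere on $M$. 2. $\rho+p\ge 0$ and $\rho+3p\ge 0$ hold everywhere on $M$ if and only if the strong energy condition holds. 3. If $\rho>0$ and $p\ge 0$ everywhere on $M$, then $K(T)<0$ for all timelike planes $T$. -/

import Mathlib

set_option maxSynthPendingDepth 3

open scoped Manifold ContDiff

noncomputable section

namespace FLRW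

/-! ### Levi-Civita curvature of a metric in coordinates -/

section Coordinates

variable {E : Type*} [NormedAddCommGroup E] [NormedSpace ℝ E]

/-- Christoffel symbols of the metric `G` on (an open subset of) the vector space `E`: the vector
`christoffel G y v w` is characterised by
`G y (christoffel G y v w) z = (D_v G (w, z) + D_w G (v, z) - D_z G (v, w)) / 2`. -/
def christoffel (G : E → E →L[ℝ] E →L[ℝ] ℝ) (y : E) : E →L[ℝ] E →L[ℝ] E :=
  let D : E →L[ℝ] E →L[ℝ] E →L[ℝ] ℝ := fderiv ℝ G y
  let flip : (E →L[ℝ] E →L[ℝ] ℝ) →L[ℝ] (E →L[ℝ] E →L[ℝ] ℝ) :=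
    (ContinuousLinearMap.flipₗᵢ ℝ E E ℝ).toContinuousLinearEquiv.toContinuousLinearMap
  let L : E →L[ℝ] E →L[ℝ] E →L[ℝ] ℝ := (1 / 2 : ℝ) • (D + D.flip - flip.comp D.flip)
  (ContinuousLinearMap.compL ℝ E (E →L[ℝ] ℝ) E (G y).inverse).comp L

/-- The Riemann tensor of `G` in coordinates, with `Γ = christoffel G` and the sign convention
`R(u, v)w = ∇_u ∇_v w - ∇_v ∇_u w - ∇_[u, v] w`, that is, for constant `u`, `v`, `w`,
`R(u, v)w = (D_u Γ)(v, w) - (D_v Γ)(u, w) + Γ(u, Γ(v, w)) - Γ(v, Γ(u, w))`. -/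
def coordRiemann (G : E → E →L[ℝ] E →L[ℝ] ℝ) (y : E) : E →L[ℝ] E →L[ℝ] E →L[ℝ] E :=
  fderiv ℝ (christoffel G) y - (fderiv ℝ (christoffel G) y).flip
    + (ContinuousLinearMap.compL ℝ E E E).bilinearComp (christoffel G y) (christoffel G y)
    - ((ContinuousLinearMap.compL ℝ E E E).bilinearComp (christoffel G y) (christoffel G y)).flip

theorem christoffel_apply (G : E → E →L[ℝ] E →L[ℝ] ℝ) (y v w : E) :
    christoffel G y v w = (G y).inverse ((1 / 2 : ℝ) • (fderiv ℝ G y v w + fderiv ℝ G y w v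
      - ((fderiv ℝ G y).flip v).flip w)) := rfl

theorem coordRiemann_apply (G : E → E →L[ℝ] E →L[ℝ] ℝ) (y u v w : E) :
    coordRiemann G y u v w =
      fderiv ℝ (christoffel G) y u v w - fderiv ℝ (christoffel G) y v u w
        + christoffel G y u (christoffel G y v w) - christoffel G y v (christoffel G y u w) := rfl

/-- The Ricci tensor `Ric(v, w) = trace (u ↦ R(u, v)w)` in coordinates. -/
def coordRicci (G : E → E →L[ℝ] E →L[ℝ] ℝ) (y : E) : E →ₗ[ℝ] E →ₗ[ℝ] ℝ :=
  LinearMap.mk₂ ℝ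
    (fun v w => LinearMap.trace ℝ E (((coordRiemann G y).flip v).flip w).toLinearMap)
    (by intros; rw [← map_add]; congr 1; ext; simp)
    (by intros; rw [← map_smul]; congr 1; ext; simp)
    (by intros; rw [← map_add]; congr 1; ext; simp)
    (by intros; rw [← map_smul]; congr 1; ext; simp)

theorem coordRicci_apply (G : E → E →L[ℝ] E →L[ℝ] ℝ) (y v w : E) :
    coordRicci G y v w =
      LinearMap.trace ℝ E (((coordRiemann G y).flip v).flip w).toLinearMap := rfl

/-- The scalar curvature in coordinates: the trace of the endomorphism of `E` obtained from the
Ricci tensor by raising an index with `G`. -/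
def coordScalar [FiniteDimensional ℝ E] (G : E → E →L[ℝ] E →L[ℝ] ℝ) (y : E) : ℝ :=
  LinearMap.trace ℝ E ((G y).inverse.toLinearMap ∘ₗ
    (LinearMap.toContinuousLinearMap : (E →ₗ[ℝ] ℝ) ≃ₗ[ℝ] (E →L[ℝ] ℝ)).toLinearMap ∘ₗ
      coordRicci G y)

end Coordinates

/-! ### Curvature of a metric on a manifold -/

section Manifold

variable {E : Type*} [NormedAddCommGroup E] [NormedSpace ℝ E]
  {H : Type*} [TopologicalSpace H] (I : ModelWithCorners ℝ E H) [I.Boundaryless]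
  (M : Type*) [TopologicalSpace M] [ChartedSpace H M]

/-- A field of bilinear forms on the tangent spaces of `M`. -/
abbrev BilinField : Type _ :=
  ∀ x : M, TangentSpace I x →L[ℝ] TangentSpace I x →L[ℝ] ℝ

variable {I} {M}

/-- The expression of `g` in the preferred chart at `x₀`: the pullback of `g` under the inverse of
the chart. -/
def chartMetric (g : BilinField I M) (x₀ : M) (y : E) : E →L[ℝ] E →L[ℝ] ℝ :=
  let d : E →L[ℝ] E := mfderiv 𝓘(ℝ, E) I (extChartAt I x₀).symm y
  ContinuousLinearMap.bilinearComp (E := E) (F := E) (g ((extChartAt I x₀).symm y)) d d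

set_option linter.unusedSectionVars false in
theorem chartMetric_apply (g : BilinField I M) (x₀ : M) (y v w : E) :
    chartMetric g x₀ y v w = g ((extChartAt I x₀).symm y)
      (mfderiv 𝓘(ℝ, E) I (extChartAt I x₀).symm y v)
      (mfderiv 𝓘(ℝ, E) I (extChartAt I x₀).symm y w) := rfl

/-- The Riemann tensor `R(u, v)w` of `g` at `x`, computed in the preferred chart at `x`. (The
tangent space at `x` is by definition the model space `E`, identified through this very chart.) -/
def riemann (g : BilinField I M) (x : M) (u v w : TangentSpace I x) : TangentSpace I x :=
  coordRiemann (chartMetric g x) (extChartAt I x x) u v w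

/-- The sectional curvature of the (nondegenerate) plane spanned by `v` and `w`. -/
def sectional (g : BilinField I M) (x : M) (v w : TangentSpace I x) : ℝ :=
  g x (riemann g x v w w) v / (g x v v * g x w w - g x v w ^ 2)

/-- The Ricci tensor `Ric(v, w) = trace (u ↦ R(u, v)w)` of `g` at `x`. -/
def ricci (g : BilinField I M) (x : M) (v w : TangentSpace I x) : ℝ :=
  coordRicci (chartMetric g x) (extChartAt I x x) v w

/-- The scalar curvature of `g` at `x`. -/
def scalar [FiniteDimensional ℝ E] (g : BilinField I M) (x : M) : ℝ :=
  coordScalar (chartMetric g x) (extChartAt I x x)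

/-- Everywhere nonpositive timelike sectional curvatures: `K(T) ≤ 0` for every point `x` and every
timelike plane `T` of `T_x M`, given by a basis `u, e` that is orthonormal
(`g(u, u) = -1`, `g(e, e) = 1`, `g(u, e) = 0`). -/
def TimelikeSectionalNonpos (g : BilinField I M) : Prop :=
  ∀ (x : M) (u e : TangentSpace I x), g x u u = -1 → g x e e = 1 → g x u e = 0 →
    sectional g x u e ≤ 0

/-- All timelike sectional curvatures are strictly negative. -/
def TimelikeSectionalNeg (g : BilinField I M) : Prop :=
  ∀ (x : M) (u e : TangentSpace I x), g x u u = -1 → g x e e = 1 → g x u e = 0 →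
    sectional g x u e < 0

/-- The strong energy condition `Ric(X, X) ≥ 0` for all timelike vectors `X`. -/
def StrongEnergyCondition (g : BilinField I M) : Prop :=
  ∀ (x : M) (X : TangentSpace I x), g x X X < 0 → 0 ≤ ricci g x X X

/-- The Einstein equations `Ric - R g / 2 = 8 π T` for a perfect fluid with energy density `ρ`,
pressure `p` and unit velocity field `U`, that is, with `T = (ρ + p) U♭ ⊗ U♭ + p g`. -/
def EinsteinPerfectFluid [FiniteDimensional ℝ E] (g : BilinField I M)
    (U : ∀ x : M, TangentSpace I x) (ρ p : M → ℝ) : Prop :=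
  ∀ (x : M) (X Y : TangentSpace I x),
    ricci g x X Y - 1 / 2 * scalar g x * g x X Y =
      8 * Real.pi * ((ρ x + p x) * (g x (U x) X * g x (U x) Y) + p x * g x X Y)

/-- All tangent planes have sectional curvature `k`. -/
def HasConstantCurvature (g : BilinField I M) (k : ℝ) : Prop :=
  ∀ (x : M) (v w : TangentSpace I x), LinearIndependent ℝ ![v, w] → sectional g x v w = k

end Manifold

/-! ### FLRW spacetimes -/

/-- The data of a (four-dimensional) FLRW spacetime `-dt² + a(t)² h` on `J × S`: an open interval
`J`, a positive smooth scale factor `a` on `J`, and a smooth Riemannian metric `h` of constant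
curvature on the three-manifold `S`. -/
structure FLRWData (S : Type*) [TopologicalSpace S] [ChartedSpace (EuclideanSpace ℝ (Fin 3)) S]
    [IsManifold 𝓘(ℝ, EuclideanSpace ℝ (Fin 3)) ∞ S] where
  /-- The time interval. -/
  J : TopologicalSpace.Opens ℝ
  nonempty : (J : Set ℝ).Nonempty
  ordConnected : (J : Set ℝ).OrdConnected
  /-- The scale factor (only its values on `J` matter). -/
  a : ℝ → ℝ
  a_smooth : ContDiffOn ℝ ∞ a J
  a_pos : ∀ t ∈ J, 0 < a t
  /-- The spatial metric. -/
  h : Bundle.ContMDiffRiemannianMetric 𝓘(ℝ, EuclideanSpace ℝ (Fin 3)) ∞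
    (EuclideanSpace ℝ (Fin 3))
    (fun s : S => TangentSpace 𝓘(ℝ, EuclideanSpace ℝ (Fin 3)) s)
  /-- The spatial curvature. -/
  k : ℝ
  constantCurvature : HasConstantCurvature (fun s => h.inner s) k

namespace FLRWData

variable {S : Type*} [TopologicalSpace S] [ChartedSpace (EuclideanSpace ℝ (Fin 3)) S]
  [IsManifold 𝓘(ℝ, EuclideanSpace ℝ (Fin 3)) ∞ S]

/-- The model with corners of the four-manifold `J × S`. -/
abbrev model : ModelWithCorners ℝ (ℝ × EuclideanSpace ℝ (Fin 3))
    (ModelProd ℝ (EuclideanSpace ℝ (Fin 3))) :=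
  𝓘(ℝ, ℝ).prod 𝓘(ℝ, EuclideanSpace ℝ (Fin 3))

/-- The spacetime metric `g = -dt² + a(t)² h` on `J × S`. -/
def metric (F : FLRWData S) : BilinField model (F.J × S) := fun q =>
  (-((ContinuousLinearMap.mul ℝ ℝ).bilinearComp
      (ContinuousLinearMap.fst ℝ ℝ (EuclideanSpace ℝ (Fin 3)))
      (ContinuousLinearMap.fst ℝ ℝ (EuclideanSpace ℝ (Fin 3))))
    + F.a q.1 ^ 2 • ContinuousLinearMap.bilinearComp
      (E := EuclideanSpace ℝ (Fin 3)) (F := EuclideanSpace ℝ (Fin 3)) (F.h.inner q.2)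
      (ContinuousLinearMap.snd ℝ ℝ (EuclideanSpace ℝ (Fin 3)))
      (ContinuousLinearMap.snd ℝ ℝ (EuclideanSpace ℝ (Fin 3))) :
    (ℝ × EuclideanSpace ℝ (Fin 3)) →L[ℝ] (ℝ × EuclideanSpace ℝ (Fin 3)) →L[ℝ] ℝ)

theorem metric_apply (F : FLRWData S) (q : F.J × S) (τ σ : ℝ) (v w : EuclideanSpace ℝ (Fin 3)) :
    F.metric q ((τ, v) : ℝ × EuclideanSpace ℝ (Fin 3)) ((σ, w) : ℝ × EuclideanSpace ℝ (Fin 3)) =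
      -(τ * σ) + F.a q.1 ^ 2 * F.h.inner q.2 v w := rfl

/-- The comoving unit timelike vector field `∂_t`. -/
def comoving (F : FLRWData S) (q : F.J × S) : TangentSpace model q :=
  ((1, 0) : ℝ × EuclideanSpace ℝ (Fin 3))

end FLRWData

end FLRW

end

open scoped Topology

noncomputable section

namespace FLRW

/-! ### Levi-Civita calculus for a metric on an open set of a vector space. -/

section Coordinates

variable {E : Type*} [NormedAddCommGroup E] [NormedSpace ℝ E]

/-! At each point the curvature of an FLRW metric is governed by two numbers: A = a''/a
(`radialCurvature`) and B = (k + a'²)/a² (`spaceCurvature`). In the preferred charts the metric is a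
warped product (`chartMetric_metric`), whose Riemann tensor is computed in `coordRiemann_warped`.
The Riemann tensor of the slice is in turn fixed by its constant sectional curvature
(`coordRiemann_of_sectional_eq`).

All conditions then become linear inequalities in A and B. A timelike plane has curvature A + (A -
B)d, where d ≥ 0 is the Gram determinant of the spatial parts and can be any s² (`sectional_eq`).
Hence K ≤ 0 means A ≤ 0 and A ≤ B. For X = (1, x) with |x|² = r in [0, 1), Ric(X, X) = -3A + (A +
2B)r is affine in r. Its values at the ends r = 0 and r = 1 are -3A and 2(B - A), so the strong
energy condition is the same pair of inequalities. The Einstein equations say 8πρ = 3B and 8πp = -2A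
- B. Therefore 8π(ρ + p) = 2(B - A) and 8π(ρ + 3p) = -6A, which is the same pair once more. -/

theorem christoffel_congr {G G' : E → E →L[ℝ] E →L[ℝ] ℝ} {y : E} (h : G =ᶠ[𝓝 y] G') :
    christoffel G =ᶠ[𝓝 y] christoffel G' := by
  filter_upwards [h.eventuallyEq_nhds] with z hz
  simp only [christoffel, hz.fderiv_eq, hz.eq_of_nhds]

/-- Curvature depends only on the germ of the metric. This matters because the chart expression of
the spacetime metric is identified with a warped product only near the point. -/
theorem coordRiemann_congr {G G' : E → E →L[ℝ] E →L[ℝ] ℝ} {y : E} (h : G =ᶠ[𝓝 y] G') :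
    coordRiemann G y = coordRiemann G' y := by
  have h1 := christoffel_congr h
  simp only [coordRiemann, h1.fderiv_eq, h1.eq_of_nhds]

theorem coordRicci_congr {G G' : E → E →L[ℝ] E →L[ℝ] ℝ} {y : E} (h : G =ᶠ[𝓝 y] G') :
    coordRicci G y = coordRicci G' y := by
  ext v w
  simp only [coordRicci_apply, coordRiemann_congr h]

theorem coordScalar_congr [FiniteDimensional ℝ E] {G G' : E → E →L[ℝ] E →L[ℝ] ℝ} {y : E}
    (h : G =ᶠ[𝓝 y] G') : coordScalar G y = coordScalar G' y := by
  simp only [coordScalar, coordRicci_congr h, h.eq_of_nhds]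

theorem apply_inverse_of_isInvertible {B : E →L[ℝ] E →L[ℝ] ℝ} (hB : B.IsInvertible)
    (f : E →L[ℝ] ℝ) : B (B.inverse f) = f := by
  obtain ⟨e, rfl⟩ := hB
  simp

theorem inverse_apply_of_isInvertible {B : E →L[ℝ] E →L[ℝ] ℝ} (hB : B.IsInvertible)
    (v : E) : B.inverse (B v) = v := by
  obtain ⟨e, rfl⟩ := hB
  simp

theorem apply_christoffel {G : E → E →L[ℝ] E →L[ℝ] ℝ} {y : E} (hG : (G y).IsInvertible)
    (v w z : E) : G y (christoffel G y v w) z =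
      1 / 2 * (fderiv ℝ G y v w z + fderiv ℝ G y w v z - fderiv ℝ G y z v w) := by
  rw [christoffel_apply, apply_inverse_of_isInvertible hG]
  simp [smul_eq_mul]

/-- The Christoffel symbols are determined by the Koszul formula. -/
theorem christoffel_eq_of_forall {G : E → E →L[ℝ] E →L[ℝ] ℝ} {y : E} (hG : (G y).IsInvertible)
    {v w X : E} (h : ∀ z, G y X z =
      1 / 2 * (fderiv ℝ G y v w z + fderiv ℝ G y w v z - fderiv ℝ G y z v w)) :
    christoffel G y v w = X := by
  have : G y (christoffel G y v w) = G y X := by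
    ext z
    rw [apply_christoffel hG, h]
  rw [← inverse_apply_of_isInvertible hG (christoffel G y v w), this,
    inverse_apply_of_isInvertible hG]

theorem ContDiffAt.christoffel [CompleteSpace E] {G : E → E →L[ℝ] E →L[ℝ] ℝ} {y : E}
    (hG : ContDiffAt ℝ ∞ G y) (hi : (G y).IsInvertible) :
    ContDiffAt ℝ ∞ (FLRW.christoffel G) y := by
  have hD : ContDiffAt ℝ ∞ (fderiv ℝ G) y := hG.fderiv_right (by simp)
  have hinv : ContDiffAt ℝ ∞ (fun z => (G z).inverse) y :=
    (hi.contDiffAt_map_inverse).comp y hG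
  let T := (ContinuousLinearMap.flipₗᵢ ℝ E E
    (E →L[ℝ] ℝ)).toContinuousLinearEquiv.toContinuousLinearMap
  let flip : (E →L[ℝ] E →L[ℝ] ℝ) →L[ℝ] (E →L[ℝ] E →L[ℝ] ℝ) :=
    (ContinuousLinearMap.flipₗᵢ ℝ E E ℝ).toContinuousLinearEquiv.toContinuousLinearMap
  have hT : ContDiffAt ℝ ∞ (fun z => T (fderiv ℝ G z)) y := T.contDiff.contDiffAt.comp y hD
  have hfT : ContDiffAt ℝ ∞ (fun z => flip.comp (T (fderiv ℝ G z))) y :=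
    contDiffAt_const.clm_comp hT
  have hL : ContDiffAt ℝ ∞ (fun z => (1 / 2 : ℝ) • (fderiv ℝ G z + T (fderiv ℝ G z) -
      flip.comp (T (fderiv ℝ G z)))) y := 
    ContDiffAt.const_smul (1 / 2 : ℝ) ((hD.add hT).sub hfT)
  exact ((ContinuousLinearMap.compL ℝ E (E →L[ℝ] ℝ) E).contDiff.contDiffAt.comp y hinv).clm_comp hL

theorem fderiv_clm_apply₂ {F₁ F₂ F₃ : Type*} [NormedAddCommGroup F₁] [NormedSpace ℝ F₁]
    [NormedAddCommGroup F₂] [NormedSpace ℝ F₂] [NormedAddCommGroup F₃] [NormedSpace ℝ F₃]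
    {G : E → F₁ →L[ℝ] F₂ →L[ℝ] F₃} {y : E} (hG : DifferentiableAt ℝ G y) (u : E) (v : F₁) (w : F₂) :
    fderiv ℝ G y u v w = fderiv ℝ (fun z => G z v w) y u := by
  have h1 : HasFDerivAt (fun z => G z v) ((fderiv ℝ G y).flip v) y := by
    simpa using hG.hasFDerivAt.clm_apply (hasFDerivAt_const v y)
  have h2 : HasFDerivAt (fun z => G z v w) (((fderiv ℝ G y).flip v).flip w) y := by
    simpa using h1.clm_apply (hasFDerivAt_const w y)
  rw [h2.fderiv]; rfl

theorem fderiv_symm_of_eventually_symm {G : E → E →L[ℝ] E →L[ℝ] ℝ} {y : E}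
    (hG : DifferentiableAt ℝ G y) (hs : ∀ᶠ z in 𝓝 y, ∀ v w, G z v w = G z w v) (u v w : E) :
    fderiv ℝ G y u v w = fderiv ℝ G y u w v := by
  rw [fderiv_clm_apply₂ hG, fderiv_clm_apply₂ hG]
  congr 1
  exact Filter.EventuallyEq.fderiv_eq (hs.mono fun z hz => hz v w)

theorem coordRiemann_antisymm (G : E → E →L[ℝ] E →L[ℝ] ℝ) (y u v w : E) :
    coordRiemann G y u v w = -coordRiemann G y v u w := by
  simp only [coordRiemann_apply]; abel

/-- A smooth nondegenerate symmetric bilinear form near a point of a vector space. -/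
structure IsMetricAt (G : E → E →L[ℝ] E →L[ℝ] ℝ) (y : E) : Prop where
  eventually_contDiffAt : ∀ᶠ z in 𝓝 y, ContDiffAt ℝ ∞ G z
  symm : ∀ᶠ z in 𝓝 y, ∀ v w, G z v w = G z w v
  isInvertible : (G y).IsInvertible

namespace IsMetricAt

variable {G : E → E →L[ℝ] E →L[ℝ] ℝ} {y : E}

theorem contDiffAt (h : IsMetricAt G y) : ContDiffAt ℝ ∞ G y :=
  h.eventually_contDiffAt.self_of_nhds

/-- Invertible operators form an open set. The identities proved at one point thus hold nearby and
may be differentiated. -/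
theorem eventually [CompleteSpace E] (h : IsMetricAt G y) : ∀ᶠ z in 𝓝 y, IsMetricAt G z := by
  have hopen : IsOpen {f : E →L[ℝ] (E →L[ℝ] ℝ) | f.IsInvertible} :=
    ContinuousLinearEquiv.isOpen
  filter_upwards [h.eventually_contDiffAt.eventually_nhds, h.symm.eventually_nhds,
    h.contDiffAt.continuousAt.eventually_mem (hopen.mem_nhds h.isInvertible)] with z h1 h2 h3
  exact ⟨h1, h2, h3⟩

theorem differentiableAt (h : IsMetricAt G y) : DifferentiableAt ℝ G y :=
  h.contDiffAt.differentiableAt (by simp)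

theorem differentiableAt_christoffel [CompleteSpace E] (h : IsMetricAt G y) :
    DifferentiableAt ℝ (christoffel G) y :=
  (ContDiffAt.christoffel h.contDiffAt h.isInvertible).differentiableAt (by simp)

theorem symm_apply (h : IsMetricAt G y) (v w : E) : G y v w = G y w v :=
  h.symm.self_of_nhds v w

theorem fderiv_symm (h : IsMetricAt G y) (u v w : E) :
    fderiv ℝ G y u v w = fderiv ℝ G y u w v :=
  fderiv_symm_of_eventually_symm h.differentiableAt h.symm u v w

theorem christoffel_symm (h : IsMetricAt G y) (v w : E) :
    christoffel G y v w = christoffel G y w v := by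
  refine christoffel_eq_of_forall h.isInvertible fun z => ?_
  rw [apply_christoffel h.isInvertible, h.fderiv_symm z v w]
  ring

/-- The Levi-Civita connection is compatible with the metric. -/
theorem fderiv_apply (h : IsMetricAt G y) (u v w : E) :
    fderiv ℝ G y u v w = G y (christoffel G y u v) w + G y v (christoffel G y u w) := by
  rw [h.symm_apply v, apply_christoffel h.isInvertible, apply_christoffel h.isInvertible,
    h.fderiv_symm v u w, h.fderiv_symm w u v, h.fderiv_symm u w v]
  ring

theorem fderiv_apply_apply {X Z : E → E} (h : IsMetricAt G y) (hX : DifferentiableAt ℝ X y)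
    (hZ : DifferentiableAt ℝ Z y) (u : E) :
    fderiv ℝ (fun z => G z (X z) (Z z)) y u = fderiv ℝ G y u (X y) (Z y)
      + G y (fderiv ℝ X y u) (Z y) + G y (X y) (fderiv ℝ Z y u) := by
  have := (h.differentiableAt.hasFDerivAt.clm_apply hX.hasFDerivAt).clm_apply hZ.hasFDerivAt
  rw [this.fderiv]
  simp
  ring

theorem fderiv_christoffel_symm [CompleteSpace E] (h : IsMetricAt G y) (u v w : E) :
    fderiv ℝ (christoffel G) y u v w = fderiv ℝ (christoffel G) y u w v := by
  rw [fderiv_clm_apply₂ h.differentiableAt_christoffel,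
    fderiv_clm_apply₂ h.differentiableAt_christoffel]
  congr 1
  exact Filter.EventuallyEq.fderiv_eq (h.eventually.mono fun z hz => hz.christoffel_symm v w)

/-- The first Bianchi identity. -/
theorem bianchi [CompleteSpace E] (h : IsMetricAt G y) (u v w : E) :
    coordRiemann G y u v w + coordRiemann G y v w u + coordRiemann G y w u v = 0 := by
  simp only [coordRiemann_apply]
  rw [h.fderiv_christoffel_symm u v w, h.fderiv_christoffel_symm v w u,
    h.fderiv_christoffel_symm w u v, h.christoffel_symm v w, h.christoffel_symm u w,
    h.christoffel_symm v u]
  abel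

/-- This is metric compatibility (`fderiv_apply`) differentiated once more, in the direction `u`. -/
theorem fderiv_fderiv_apply [CompleteSpace E] (h : IsMetricAt G y) (u v w z : E) :
    fderiv ℝ (fderiv ℝ G) y u v w z =
      G y (fderiv ℝ (christoffel G) y u v w) z + G y w (fderiv ℝ (christoffel G) y u v z)
      + fderiv ℝ G y u (christoffel G y v w) z + fderiv ℝ G y u w (christoffel G y v z) := by
  have hD : DifferentiableAt ℝ (fderiv ℝ G) y :=
    (h.contDiffAt.fderiv_right (m := ∞) (by simp)).differentiableAt (by simp)
  have hΓ := h.differentiableAt_christoffel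
  have h1 : DifferentiableAt ℝ (fun x => fderiv ℝ G x v) y :=
    hD.clm_apply (differentiableAt_const v)
  have h0 : fderiv ℝ (fderiv ℝ G) y u v = fderiv ℝ (fun x => fderiv ℝ G x v) y u := by
    have := hD.hasFDerivAt.clm_apply (hasFDerivAt_const v y)
    rw [this.fderiv]; simp
  have hX (w : E) : DifferentiableAt ℝ (fun x => christoffel G x v w) y :=
    (hΓ.clm_apply (differentiableAt_const v)).clm_apply (differentiableAt_const w)
  have hev : (fun x => fderiv ℝ G x v w z) =ᶠ[𝓝 y]
      (fun x => G x (christoffel G x v w) z + G x w (christoffel G x v z)) :=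
    h.eventually.mono fun x hx => hx.fderiv_apply v w z
  have hG := h.differentiableAt
  rw [h0, fderiv_clm_apply₂ h1, hev.fderiv_eq, fderiv_fun_add, add_apply,
    h.fderiv_apply_apply (hX w) (differentiableAt_const z),
    h.fderiv_apply_apply (differentiableAt_const w) (hX z),
    fderiv_clm_apply₂ hΓ, fderiv_clm_apply₂ hΓ]
  · simp
    ring
  · exact (hG.clm_apply (hX w)).clm_apply (differentiableAt_const z)
  · exact (hG.clm_apply (differentiableAt_const w)).clm_apply (hX z)

/-- The curvature endomorphisms `R(u, v)` are skew-adjoint. -/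
theorem apply_coordRiemann_skew [CompleteSpace E] (h : IsMetricAt G y) (u v w z : E) :
    G y (coordRiemann G y u v w) z = -G y (coordRiemann G y u v z) w := by
  -- Once second derivatives are expanded by metric compatibility, their symmetry in `u`, `v` is
  -- exactly the claim.
  have hsymm : fderiv ℝ (fderiv ℝ G) y u v w z = fderiv ℝ (fderiv ℝ G) y v u w z := by
    have : IsSymmSndFDerivAt ℝ G y := h.contDiffAt.isSymmSndFDerivAt (by
      simpa using WithTop.coe_le_coe.2 (le_top : (2 : ℕ∞) ≤ ⊤))
    rw [this u v]
  rw [h.fderiv_fderiv_apply, h.fderiv_fderiv_apply] at hsymm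
  simp only [h.fderiv_apply] at hsymm
  rw [h.symm_apply (coordRiemann G y u v z) w]
  simp only [coordRiemann_apply, map_add, map_sub, add_apply,
    sub_apply]
  linarith

end IsMetricAt

/-! ### Algebraic curvature tensors and constant sectional curvature. -/

/-- An algebraic curvature tensor whose sectional curvatures vanish is zero. -/
theorem algebraicCurvature_eq_zero {E : Type*} [AddCommGroup E] {D : E → E → E → E → ℝ}
    (add₁ : ∀ u u' v w z, D (u + u') v w z = D u v w z + D u' v w z)
    (anti₁₂ : ∀ u v w z, D u v w z = -D v u w z) (anti₃₄ : ∀ u v w z, D u v w z = -D u v z w)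
    (cyclic : ∀ u v w z, D u v w z + D v w u z + D w u v z = 0)
    (sec : ∀ u v, D u v v u = 0) (u v w z : E) : D u v w z = 0 := by
  -- Pair symmetry: the four cyclic identities are combined using the two antisymmetries.
  have pair (u v w z : E) : D u v w z = D w z u v := by
    linarith [cyclic u v w z, cyclic v w z u, cyclic w z u v, cyclic z u v w,
      anti₃₄ v w z u, anti₁₂ v w u z, anti₃₄ w z u v, anti₁₂ w z v u, anti₃₄ u v w z,
      anti₃₄ v w u z, anti₃₄ w u v z, anti₁₂ w u v z, anti₁₂ w u z v, anti₃₄ z u v w,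
      anti₁₂ z u v w, anti₁₂ z u w v, anti₃₄ u v z w, anti₁₂ u v z w, anti₁₂ z v u w,
      anti₃₄ z v u w, anti₁₂ u w z v, anti₃₄ z w u v, anti₃₄ u z v w, anti₁₂ v z w u,
      anti₁₂ u z v w, anti₃₄ z v w u, anti₁₂ z v w u, anti₃₄ u w z v, anti₁₂ v z u w]
  have add₂ (u v v' w z : E) : D u (v + v') w z = D u v w z + D u v' w z := by
    rw [anti₁₂, add₁, anti₁₂ u v, anti₁₂ u v']; ring
  have add₃ (u v w w' z : E) : D u v (w + w') z = D u v w z + D u v w' z := by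
    rw [pair, add₁, pair w, pair w']
  have add₄ (u v w z z' : E) : D u v w (z + z') = D u v w z + D u v w z' := by
    rw [anti₃₄, add₃, anti₃₄ u v w z, anti₃₄ u v w z']; ring
  -- Polarisation in the outer slots here, and in the inner slots in `h2`, makes `D` antisymmetric
  -- in its middle arguments. The cyclic identity then reads 3D = 0.
  have h1 (u v z : E) : D u v v z = 0 := by
    have h := sec (u + z) v
    rw [add₁, add₄, add₄, sec, sec] at h
    have h2 : D z v v u = D u v v z := by
      rw [pair z v v u, anti₁₂ v u, anti₃₄ u v z v]; ring
    linarith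
  have h2 (u v w z : E) : D u v w z = -D u w v z := by
    have h := h1 u (v + w) z
    rw [add₂, add₃, add₃, h1, h1] at h
    linarith
  linarith [cyclic u v w z, h2 u v w z, anti₁₂ u w v z, anti₁₂ v w u z, h2 v u w z, h2 w v u z,
    anti₁₂ w v u z, anti₁₂ u v w z]

/-- Strict Cauchy–Schwarz: the vector `B w w • v - B v w • w` is nonzero, and its square is `B w w`
times the Gram determinant. -/
theorem gram_pos {B : E →L[ℝ] E →L[ℝ] ℝ} (hs : ∀ v w, B v w = B w v)
    (hp : ∀ v, v ≠ 0 → 0 < B v v) {v w : E} (hvw : LinearIndependent ℝ ![v, w]) :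
    0 < B v v * B w w - B v w ^ 2 := by
  have hw : w ≠ 0 := hvw.ne_zero 1
  have hww := hp w hw
  have hx : B w w • v - B v w • w ≠ 0 := by
    intro h
    have := (LinearIndependent.pair_iff.1 hvw) (B w w) (-B v w) (by rw [← h]; module)
    exact hww.ne' this.1
  have h := hp _ hx
  simp only [map_sub, map_smul, sub_apply, smul_apply, smul_eq_mul,
    hs w v] at h
  have : 0 < B w w * (B v v * B w w - B v w ^ 2) := by linarith
  exact pos_of_mul_pos_right this hww.le

theorem gram_nonneg {B : E →L[ℝ] E →L[ℝ] ℝ} (hs : ∀ v w, B v w = B w v)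
    (hp : ∀ v, v ≠ 0 → 0 < B v v) (v w : E) : 0 ≤ B v v * B w w - B v w ^ 2 := by
  by_cases hw : w = 0
  · simp [hw]
  have hww := hp w hw
  have h : 0 ≤ B (B w w • v - B v w • w) (B w w • v - B v w • w) := by
    by_cases hx : B w w • v - B v w • w = 0
    · simp [hx]
    · exact (hp _ hx).le
  simp only [map_sub, map_smul, sub_apply, smul_apply, smul_eq_mul, hs w v] at h
  have : 0 ≤ B w w * (B v v * B w w - B v w ^ 2) := by linarith
  exact nonneg_of_mul_nonneg_right this hww

namespace IsMetricAt

variable {G : E → E →L[ℝ] E →L[ℝ] ℝ} {y : E}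

/-- The Riemann tensor of a space of constant sectional curvature. -/
theorem coordRiemann_of_sectional_eq [CompleteSpace E] (h : IsMetricAt G y) {k : ℝ}
    (hk : ∀ v w, G y (coordRiemann G y v w w) v = k * (G y v v * G y w w - G y v w ^ 2))
    (u v w : E) : coordRiemann G y u v w = k • (G y v w • u - G y u w • v) := by
  rw [← sub_eq_zero, ← inverse_apply_of_isInvertible h.isInvertible (_ - _)]
  suffices H : G y (coordRiemann G y u v w - k • (G y v w • u - G y u w • v)) = 0 by
    rw [H, map_zero]
  ext z
  -- The difference from the model tensor of curvature `k` is an algebraic curvature tensor with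
  -- zero sectional curvatures.
  have key := algebraicCurvature_eq_zero (D := fun u v w z => G y (coordRiemann G y u v w) z
    - k * (G y v w * G y u z - G y u w * G y v z)) ?_ ?_ ?_ ?_ ?_ u v w z
  · simpa using key
  · intro u u' v w z; simp; ring
  · intro u v w z
    simp only [coordRiemann_antisymm G y u v, map_neg, neg_apply]
    ring
  · intro u v w z
    simp only [h.apply_coordRiemann_skew u v w z]
    ring
  · intro u v w z
    have hb := congrArg (fun x => G y x z) (h.bianchi u v w)
    simp only [map_add, add_apply, map_zero, zero_apply] at hb
    simp only [h.symm_apply w v, h.symm_apply u w, h.symm_apply v u]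
    linarith
  · intro u v
    simp only [hk u v, h.symm_apply v u]
    ring

end IsMetricAt

theorem isInvertible_of_nondegenerate [FiniteDimensional ℝ E] {B : E →L[ℝ] E →L[ℝ] ℝ}
    (hB : ∀ v, (∀ w, B v w = 0) → v = 0) : B.IsInvertible := by
  have hinj : Function.Injective B.toLinearMap :=
    (injective_iff_map_eq_zero B.toLinearMap).2 fun v hv => hB v fun w => by
      simpa using congrArg (fun f : E →L[ℝ] ℝ => f w) hv
  have hdim : Module.finrank ℝ E = Module.finrank ℝ (E →L[ℝ] ℝ) := by
    rw [← (LinearMap.toContinuousLinearMap : (E →ₗ[ℝ] ℝ) ≃ₗ[ℝ] (E →L[ℝ] ℝ)).finrank_eq]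
    exact (Subspace.dual_finrank_eq (K := ℝ) (V := E)).symm
  let e := (LinearMap.linearEquivOfInjective B.toLinearMap hinj hdim).toContinuousLinearEquiv
  exact ⟨e, by ext; rfl⟩

/-! ### Warped products -/

/-- The warped product metric `-dt² + a(t)² H` on `ℝ × E`. -/
def warped (a : ℝ → ℝ) (H : E → E →L[ℝ] E →L[ℝ] ℝ) (p : ℝ × E) : ℝ × E →L[ℝ] ℝ × E →L[ℝ] ℝ :=
  -((ContinuousLinearMap.mul ℝ ℝ).bilinearComp (ContinuousLinearMap.fst ℝ ℝ E)
      (ContinuousLinearMap.fst ℝ ℝ E))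
    + a p.1 ^ 2 • (H p.2).bilinearComp (ContinuousLinearMap.snd ℝ ℝ E)
      (ContinuousLinearMap.snd ℝ ℝ E)

@[simp]
theorem warped_apply (a : ℝ → ℝ) (H : E → E →L[ℝ] E →L[ℝ] ℝ) (p V W : ℝ × E) :
    warped a H p V W = -(V.1 * W.1) + a p.1 ^ 2 * H p.2 V.2 W.2 := rfl

section Warped

variable {a : ℝ → ℝ} {H : E → E →L[ℝ] E →L[ℝ] ℝ} {t : ℝ} {y : E}

theorem warped_isInvertible [FiniteDimensional ℝ E] (h0 : a t ≠ 0) (hH : (H y).IsInvertible) :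
    (warped a H (t, y)).IsInvertible := by
  refine isInvertible_of_nondegenerate fun V hV => ?_
  have h1 := hV (1, 0)
  have h2 : H y V.2 = 0 := by
    ext w
    simpa [h0] using hV (0, w)
  have h3 := inverse_apply_of_isInvertible hH V.2
  rw [h2, map_zero] at h3
  exact Prod.ext (by simpa using h1) h3.symm

theorem ContDiffAt.warped (ha : ContDiffAt ℝ ∞ a t) (hH : ContDiffAt ℝ ∞ H y) :
    ContDiffAt ℝ ∞ (FLRW.warped a H) (t, y) := by
  have h1 : ContDiffAt ℝ ∞ (fun p : ℝ × E => a p.1) (t, y) :=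
    ContDiffAt.comp (t, y) (g := a) ha contDiffAt_fst
  have h2 : ContDiffAt ℝ ∞ (fun p : ℝ × E => H p.2) (t, y) :=
    ContDiffAt.comp (t, y) (g := H) hH contDiffAt_snd
  -- Precomposition with the projection. It turns the pullback of `H` into compositions with
  -- constant operators.
  let T : (E →L[ℝ] ℝ) →L[ℝ] (ℝ × E →L[ℝ] ℝ) :=
    (ContinuousLinearMap.compL ℝ (ℝ × E) E ℝ).flip (ContinuousLinearMap.snd ℝ ℝ E)
  have h3 : ContDiffAt ℝ ∞
      (fun p : ℝ × E => (T.comp (H p.2)).comp (ContinuousLinearMap.snd ℝ ℝ E)) (t, y) :=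
    (contDiffAt_const.clm_comp h2).clm_comp contDiffAt_const
  exact contDiffAt_const.add ((h1.pow 2).smul h3)

theorem IsMetricAt.warped [FiniteDimensional ℝ E] (ha : ∀ᶠ s in 𝓝 t, ContDiffAt ℝ ∞ a s)
    (h0 : a t ≠ 0) (hH : IsMetricAt H y) : IsMetricAt (warped a H) (t, y) where
  eventually_contDiffAt := by
    rw [nhds_prod_eq]
    filter_upwards [ha.prod_mk hH.eventually_contDiffAt] with p hp
    exact ContDiffAt.warped hp.1 hp.2
  symm := by
    rw [nhds_prod_eq]
    filter_upwards [hH.symm.prod_inr (𝓝 t)] with p hp V W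
    rw [warped_apply, warped_apply, hp, mul_comm V.1]
  isInvertible := warped_isInvertible h0 hH.isInvertible

theorem hasFDerivAt_comp_fst {F : Type*} [NormedAddCommGroup F] [NormedSpace ℝ F] {f : ℝ → F}
    {f' : F} (hf : HasDerivAt f f' t) :
    HasFDerivAt (fun p : ℝ × E => f p.1)
      ((ContinuousLinearMap.fst ℝ ℝ E).smulRight f') (t, y) := by
  have := HasFDerivAt.comp (t, y) (g := f) hf.hasFDerivAt (hasFDerivAt_fst (𝕜 := ℝ) (F := E))
  refine this.congr_fderiv ?_
  ext <;> simp

theorem hasFDerivAt_comp_snd {F : Type*} [NormedAddCommGroup F] [NormedSpace ℝ F] {f : E → F}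
    (hf : DifferentiableAt ℝ f y) :
    HasFDerivAt (fun p : ℝ × E => f p.2)
      ((fderiv ℝ f y).comp (ContinuousLinearMap.snd ℝ ℝ E)) (t, y) :=
  HasFDerivAt.comp (t, y) (g := f) hf.hasFDerivAt hasFDerivAt_snd

theorem fderiv_warped_apply (ha : ContDiffAt ℝ ∞ a t) (hH : ContDiffAt ℝ ∞ H y)
    (U V W : ℝ × E) :
    fderiv ℝ (warped a H) (t, y) U V W =
      2 * a t * deriv a t * U.1 * H y V.2 W.2 + a t ^ 2 * fderiv ℝ H y U.2 V.2 W.2 := by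
  have hHd : DifferentiableAt ℝ H y := hH.differentiableAt (by simp)
  have had : HasDerivAt a (deriv a t) t := (ha.differentiableAt (by simp)).hasDerivAt
  rw [fderiv_clm_apply₂ ((ContDiffAt.warped ha hH).differentiableAt (by simp)),
    fderiv_clm_apply₂ hHd]
  have h1 := hasFDerivAt_comp_fst (E := E) (y := y) (had.fun_pow 2)
  have h2 := hasFDerivAt_comp_snd (t := t)
    ((hHd.clm_apply (differentiableAt_const V.2)).clm_apply (differentiableAt_const W.2))
  have h3 := (h1.fun_mul h2).const_add (-(V.1 * W.1))
  simp only [warped_apply]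
  rw [h3.fderiv]
  simp
  ring

theorem christoffel_warped [FiniteDimensional ℝ E] (ha : ContDiffAt ℝ ∞ a t) (h0 : a t ≠ 0)
    (hH : IsMetricAt H y) (V W : ℝ × E) :
    christoffel (warped a H) (t, y) V W = (a t * deriv a t * H y V.2 W.2,
      christoffel H y V.2 W.2 + (deriv a t / a t) • (V.1 • W.2 + W.1 • V.2)) := by
  refine christoffel_eq_of_forall (warped_isInvertible h0 hH.isInvertible) fun Z => ?_
  simp only [fderiv_warped_apply ha hH.contDiffAt, warped_apply, map_add, map_smul, add_apply,
    smul_apply, smul_eq_mul, apply_christoffel hH.isInvertible]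
  field_simp
  ring

theorem fderiv_christoffel_warped [FiniteDimensional ℝ E] (ha : ∀ᶠ s in 𝓝 t, ContDiffAt ℝ ∞ a s)
    (h0 : a t ≠ 0) (hH : IsMetricAt H y) (U V W : ℝ × E) :
    fderiv ℝ (christoffel (warped a H)) (t, y) U V W =
      (U.1 * (deriv a t ^ 2 + a t * deriv (deriv a) t) * H y V.2 W.2
          + a t * deriv a t * fderiv ℝ H y U.2 V.2 W.2,
        fderiv ℝ (christoffel H) y U.2 V.2 W.2
          + (U.1 * (deriv (deriv a) t / a t - (deriv a t / a t) ^ 2)) •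
            (V.1 • W.2 + W.1 • V.2)) := by
  have hc := ha.self_of_nhds
  have had : HasDerivAt a (deriv a t) t := (hc.differentiableAt (by simp)).hasDerivAt
  have hadd : HasDerivAt (deriv a) (deriv (deriv a) t) t :=
    (((hc.fderiv_right (m := ∞) (by simp)).clm_apply contDiffAt_const).differentiableAt
      (by simp)).hasDerivAt
  have hHd := hH.differentiableAt
  have hΓ := hH.differentiableAt_christoffel
  rw [fderiv_clm_apply₂ (IsMetricAt.warped ha h0 hH).differentiableAt_christoffel,
    fderiv_clm_apply₂ hHd, fderiv_clm_apply₂ hΓ]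
  have hev : (fun p => christoffel (warped a H) p V W) =ᶠ[𝓝 (t, y)] fun p =>
      (a p.1 * deriv a p.1 * H p.2 V.2 W.2,
        christoffel H p.2 V.2 W.2 + (deriv a p.1 / a p.1) • (V.1 • W.2 + W.1 • V.2)) := by
    rw [nhds_prod_eq]
    filter_upwards [(ha.and (hc.continuousAt.eventually_ne h0)).prod_mk hH.eventually] with p hp
    exact christoffel_warped hp.1.1 hp.1.2 hp.2 V W
  rw [hev.fderiv_eq]
  have h1 := hasFDerivAt_comp_fst (E := E) (y := y) (had.fun_mul hadd)
  have h2 := hasFDerivAt_comp_snd (t := t)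
    ((hHd.clm_apply (differentiableAt_const V.2)).clm_apply (differentiableAt_const W.2))
  have h3 := hasFDerivAt_comp_fst (E := E) (y := y) (hadd.fun_div had h0)
  have h4 := hasFDerivAt_comp_snd (t := t)
    ((hΓ.clm_apply (differentiableAt_const V.2)).clm_apply (differentiableAt_const W.2))
  have h5 := (h1.fun_mul h2).prodMk (h4.fun_add (h3.smul_const (V.1 • W.2 + W.1 • V.2)))
  rw [h5.fderiv]
  ext
  · simp
    ring
  · simp only [ContinuousLinearMap.prod_apply, add_apply, ContinuousLinearMap.comp_apply,
      ContinuousLinearMap.coe_snd', ContinuousLinearMap.smulRight_apply,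
      ContinuousLinearMap.coe_fst']
    congr 2
    simp only [smul_eq_mul]
    field_simp

/-- In the time component the `deriv a t ^ 2` terms cancel, and the derivatives of `H` cancel
against its Christoffel terms by metric compatibility. -/
theorem coordRiemann_warped [FiniteDimensional ℝ E] (ha : ∀ᶠ s in 𝓝 t, ContDiffAt ℝ ∞ a s)
    (h0 : a t ≠ 0) (hH : IsMetricAt H y) (U V W : ℝ × E) :
    coordRiemann (warped a H) (t, y) U V W =
      (a t * deriv (deriv a) t * (U.1 * H y V.2 W.2 - V.1 * H y U.2 W.2),
        coordRiemann H y U.2 V.2 W.2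
          + (deriv (deriv a) t / a t * W.1) • (U.1 • V.2 - V.1 • U.2)
          + deriv a t ^ 2 • (H y V.2 W.2 • U.2 - H y U.2 W.2 • V.2)) := by
  rw [coordRiemann_apply]
  simp only [fderiv_christoffel_warped ha h0 hH, christoffel_warped ha.self_of_nhds h0 hH]
  ext
  · simp only [Prod.fst_add, Prod.fst_sub, map_add, map_smul, smul_eq_mul, hH.fderiv_apply,
      hH.christoffel_symm V.2 U.2, hH.symm_apply V.2 U.2,
      hH.symm_apply V.2 (christoffel H y U.2 W.2)]
    field_simp
    ring
  · simp only [Prod.snd_add, Prod.snd_sub, map_add, map_smul, coordRiemann_apply,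
      hH.christoffel_symm V.2 U.2]
    match_scalars <;> field_simp <;> ring

variable {k : ℝ}

theorem coordRicci_warped [FiniteDimensional ℝ E] (hE : Module.finrank ℝ E = 3)
    (ha : ∀ᶠ s in 𝓝 t, ContDiffAt ℝ ∞ a s)
    (h0 : a t ≠ 0) (hH : IsMetricAt H y)
    (hk : ∀ u v w, coordRiemann H y u v w = k • (H y v w • u - H y u w • v)) (V W : ℝ × E) :
    coordRicci (warped a H) (t, y) V W =
      -3 * (deriv (deriv a) t / a t) * (V.1 * W.1)
        + (a t * deriv (deriv a) t + 2 * (k + deriv a t ^ 2)) * H y V.2 W.2 := by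
  rw [coordRicci_apply]
  -- The endomorphism is a combination of rank-one maps and the projection to `E`. Their traces are
  -- immediate, the projection having trace 3.
  have key : (((coordRiemann (warped a H) (t, y)).flip V).flip W).toLinearMap =
      (a t * deriv (deriv a) t * H y V.2 W.2) •
        (LinearMap.fst ℝ ℝ E).smulRight ((1, 0) : ℝ × E)
      - (a t * deriv (deriv a) t * V.1) •
        (((H y).flip W.2).toLinearMap.comp (LinearMap.snd ℝ ℝ E)).smulRight ((1, 0) : ℝ × E)
      + (deriv (deriv a) t / a t * W.1) •
        (LinearMap.fst ℝ ℝ E).smulRight ((0, V.2) : ℝ × E)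
      + ((k + deriv a t ^ 2) * H y V.2 W.2 - deriv (deriv a) t / a t * W.1 * V.1) •
        LinearMap.prodMap (0 : ℝ →ₗ[ℝ] ℝ) (LinearMap.id : E →ₗ[ℝ] E)
      - (k + deriv a t ^ 2) •
        (((H y).flip W.2).toLinearMap.comp (LinearMap.snd ℝ ℝ E)).smulRight
          ((0, V.2) : ℝ × E) := by
    refine LinearMap.ext fun U => ?_
    change coordRiemann (warped a H) (t, y) U V W = _
    rw [coordRiemann_warped ha h0 hH, hk]
    ext
    · simp
      ring
    · simp
      module
  rw [key]
  simp only [map_add, map_sub, map_smul, LinearMap.trace_smulRight, LinearMap.trace_prodMap',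
    LinearMap.trace_id, hE]
  simp
  ring

theorem coordScalar_warped [FiniteDimensional ℝ E] (hE : Module.finrank ℝ E = 3)
    (ha : ∀ᶠ s in 𝓝 t, ContDiffAt ℝ ∞ a s)
    (h0 : a t ≠ 0) (hH : IsMetricAt H y)
    (hk : ∀ u v w, coordRiemann H y u v w = k • (H y v w • u - H y u w • v)) :
    coordScalar (warped a H) (t, y) =
      6 * (deriv (deriv a) t / a t + (k + deriv a t ^ 2) / a t ^ 2) := by
  have hi := warped_isInvertible h0 hH.isInvertible
  -- With an index raised, Ricci is block diagonal and scalar on each of the blocks `ℝ` and `E`.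
  have key : (warped a H (t, y)).inverse.toLinearMap ∘ₗ
      (LinearMap.toContinuousLinearMap : (ℝ × E →ₗ[ℝ] ℝ) ≃ₗ[ℝ] (ℝ × E →L[ℝ] ℝ)).toLinearMap ∘ₗ
      coordRicci (warped a H) (t, y) =
      LinearMap.prodMap ((3 * (deriv (deriv a) t / a t)) • (LinearMap.id : ℝ →ₗ[ℝ] ℝ))
        ((deriv (deriv a) t / a t + 2 * ((k + deriv a t ^ 2) / a t ^ 2)) •
          (LinearMap.id : E →ₗ[ℝ] E)) := by
    refine LinearMap.ext fun V => ?_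
    change (warped a H (t, y)).inverse (LinearMap.toContinuousLinearMap
      (coordRicci (warped a H) (t, y) V)) = _
    rw [← inverse_apply_of_isInvertible hi (LinearMap.prodMap _ _ V)]
    congr 1
    ext W
    all_goals
      simp [coordRicci_warped hE ha h0 hH hk]
      try field_simp
      try ring
  rw [coordScalar, key]
  simp only [map_smul, LinearMap.trace_prodMap', LinearMap.trace_id, hE]
  simp
  ring

end Warped

end Coordinates

/-! ### Metrics in the preferred charts -/

section Bundle

variable {EB : Type*} [NormedAddCommGroup EB] [NormedSpace ℝ EB]
  {HB : Type*} [TopologicalSpace HB] {IB : ModelWithCorners ℝ EB HB}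
  {B : Type*} [TopologicalSpace B] [ChartedSpace HB B] {n : WithTop ℕ∞}
  {F : Type*} [NormedAddCommGroup F] [NormedSpace ℝ F]
  {V : B → Type*} [TopologicalSpace (Bundle.TotalSpace F V)] [∀ b, TopologicalSpace (V b)]
  [∀ b, AddCommGroup (V b)] [∀ b, Module ℝ (V b)] [FiberBundle F V] [VectorBundle ℝ F V]
  {EM : Type*} [NormedAddCommGroup EM] [NormedSpace ℝ EM]
  {HM : Type*} [TopologicalSpace HM] {IM : ModelWithCorners ℝ EM HM}
  {M : Type*} [TopologicalSpace M] [ChartedSpace HM M]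

/-- The pairing is treated as a section of the trivial line bundle along `b`, so smoothness of
bundle-map application yields it. -/
theorem contMDiffWithinAt_inner (h : Bundle.ContMDiffRiemannianMetric IB n F V)
    {b : M → B} {v w : ∀ x, V (b x)} {s : Set M} {x : M}
    (hv : ContMDiffWithinAt IM (IB.prod 𝓘(ℝ, F)) n
      (fun m => Bundle.TotalSpace.mk' F (b m) (v m)) s x)
    (hw : ContMDiffWithinAt IM (IB.prod 𝓘(ℝ, F)) n
      (fun m => Bundle.TotalSpace.mk' F (b m) (w m)) s x) :
    ContMDiffWithinAt IM 𝓘(ℝ, ℝ) n (fun m => h.inner (b m) (v m) (w m)) s x := by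
  have hb : ContMDiffWithinAt IM IB n b s x := by
    simp only [Bundle.contMDiffWithinAt_totalSpace] at hv
    exact hv.1
  have : ContMDiffWithinAt IM (IB.prod 𝓘(ℝ, ℝ)) n
      (fun m => Bundle.TotalSpace.mk' ℝ (E := Bundle.Trivial B ℝ) (b m)
        (h.inner (b m) (v m) (w m))) s x := by
    apply ContMDiffWithinAt.clm_bundle_apply₂ (F₁ := F) (F₂ := F)
    · exact ContMDiffAt.comp_contMDiffWithinAt x h.contMDiff.contMDiffAt hb
    · exact hv
    · exact hw
  simp only [Bundle.contMDiffWithinAt_totalSpace] at this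
  exact this.2

end Bundle

section Manifold

variable {E : Type*} [NormedAddCommGroup E] [NormedSpace ℝ E]
  {M : Type*} [TopologicalSpace M] [ChartedSpace E M] [IsManifold 𝓘(ℝ, E) ∞ M]

/-- The tangent space at `x` is identified with `E` through this same chart, so the derivative is
the coordinate change of the chart with itself. -/
theorem mfderiv_extChartAt_symm_self (x : M) (v : E) :
    (mfderiv 𝓘(ℝ, E) 𝓘(ℝ, E) (extChartAt 𝓘(ℝ, E) x).symm (extChartAt 𝓘(ℝ, E) x x) v : E) = v := by
  have : IsManifold 𝓘(ℝ, E) 1 M := IsManifold.of_le (n := ∞) (by simp)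
  have h1 := TangentBundle.symmL_trivializationAt (I := 𝓘(ℝ, E)) (mem_chart_source E x)
  rw [TangentBundle.symmL_trivializationAt_eq_core (mem_chart_source E x)] at h1
  have h2 := (tangentBundleCore 𝓘(ℝ, E) M).coordChange_self (achart E x) x
    (mem_chart_source E x) v
  simp only [modelWithCornersSelf_coe, Set.range_id, mfderivWithin_univ] at h1
  exact (DFunLike.congr_fun h1 v).symm.trans h2

theorem chartMetric_self (g : BilinField 𝓘(ℝ, E) M) (x : M) (v w : E) :
    chartMetric g x (extChartAt 𝓘(ℝ, E) x x) v w = g x v w := by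
  have aux : ∀ x' : M, x' = x → ∀ v w : E, (g x' v w : ℝ) = g x v w := by rintro _ rfl _ _; rfl
  have := aux _ (extChartAt_to_inv (I := 𝓘(ℝ, E)) x) v w
  rw [chartMetric_apply, ← this]
  congr 1
  · congr 1
    exact mfderiv_extChartAt_symm_self x v
  · exact mfderiv_extChartAt_symm_self x w

/-- The coordinate vector field is the tangent map of the inverse chart applied to a constant
section. -/
theorem contMDiffOn_mfderiv_extChartAt_symm (x : M) (v : E) :
    ContMDiffOn 𝓘(ℝ, E) (𝓘(ℝ, E).prod 𝓘(ℝ, E)) ∞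
      (fun y => Bundle.TotalSpace.mk' E (E := fun m : M => TangentSpace 𝓘(ℝ, E) m)
        ((extChartAt 𝓘(ℝ, E) x).symm y)
        (mfderiv 𝓘(ℝ, E) 𝓘(ℝ, E) (extChartAt 𝓘(ℝ, E) x).symm y v))
      (extChartAt 𝓘(ℝ, E) x).target := by
  have ho : IsOpen (extChartAt 𝓘(ℝ, E) x).target := isOpen_extChartAt_target x
  have h1 := (contMDiffOn_extChartAt_symm (I := 𝓘(ℝ, E)) (n := ∞) x).contMDiffOn_tangentMapWithin
    (m := ∞) (by simp) ho.uniqueMDiffOn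
  have h2 : ContMDiffOn 𝓘(ℝ, E) (𝓘(ℝ, E).prod 𝓘(ℝ, E)) ∞
      (fun y : E => Bundle.TotalSpace.mk' E (E := fun m : E => TangentSpace 𝓘(ℝ, E) m) y v)
      (extChartAt 𝓘(ℝ, E) x).target :=
    contMDiffOn_vectorSpace_iff_contDiffOn.2 contDiffOn_const
  refine (h1.comp h2 fun y hy => hy).congr fun y hy => ?_
  simp only [Function.comp_def, tangentMapWithin]
  rw [mfderivWithin_of_isOpen ho hy]

theorem contDiffOn_chartMetric [FiniteDimensional ℝ E]
    (h : Bundle.ContMDiffRiemannianMetric 𝓘(ℝ, E) ∞ E (fun m : M => TangentSpace 𝓘(ℝ, E) m))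
    (x : M) : ContDiffOn ℝ ∞ (chartMetric (fun m => h.inner m) x)
      (extChartAt 𝓘(ℝ, E) x).target := by
  refine contDiffOn_clm_apply.2 fun v => contDiffOn_clm_apply.2 fun w => ?_
  rw [← contMDiffOn_iff_contDiffOn]
  intro y hy
  exact contMDiffWithinAt_inner h (contMDiffOn_mfderiv_extChartAt_symm x v y hy)
    (contMDiffOn_mfderiv_extChartAt_symm x w y hy)

theorem chartMetric_symm
    (h : Bundle.ContMDiffRiemannianMetric 𝓘(ℝ, E) ∞ E (fun m : M => TangentSpace 𝓘(ℝ, E) m))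
    (x : M) (y v w : E) :
    chartMetric (fun m => h.inner m) x y v w = chartMetric (fun m => h.inner m) x y w v := by
  rw [chartMetric_apply, chartMetric_apply]
  exact h.symm ((extChartAt 𝓘(ℝ, E) x).symm y) _ _

theorem chartMetric_self_pos
    (h : Bundle.ContMDiffRiemannianMetric 𝓘(ℝ, E) ∞ E (fun m : M => TangentSpace 𝓘(ℝ, E) m))
    (x : M) {v : E} (hv : v ≠ 0) :
    0 < chartMetric (fun m => h.inner m) x (extChartAt 𝓘(ℝ, E) x x) v v := by
  rw [chartMetric_self]
  exact h.pos x v hv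

theorem isMetricAt_chartMetric [FiniteDimensional ℝ E]
    (h : Bundle.ContMDiffRiemannianMetric 𝓘(ℝ, E) ∞ E (fun m : M => TangentSpace 𝓘(ℝ, E) m))
    (x : M) : IsMetricAt (chartMetric (fun m => h.inner m) x) (extChartAt 𝓘(ℝ, E) x x) where
  eventually_contDiffAt := by
    have ho : IsOpen (extChartAt 𝓘(ℝ, E) x).target := isOpen_extChartAt_target x
    filter_upwards [ho.mem_nhds (mem_extChartAt_target x)] with y hy
    exact (contDiffOn_chartMetric h x).contDiffAt (ho.mem_nhds hy)
  symm := Filter.Eventually.of_forall (chartMetric_symm h x)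
  isInvertible := isInvertible_of_nondegenerate fun v hv => by
    by_contra h0
    exact (chartMetric_self_pos h x h0).ne' (hv v)

/-- The Riemann tensor of a Riemannian manifold of constant sectional curvature. -/
theorem coordRiemann_of_hasConstantCurvature [FiniteDimensional ℝ E]
    (h : Bundle.ContMDiffRiemannianMetric 𝓘(ℝ, E) ∞ E (fun m : M => TangentSpace 𝓘(ℝ, E) m))
    {k : ℝ} (hk : HasConstantCurvature (fun m => h.inner m) k) (x : M) (u v w : E) :
    coordRiemann (chartMetric (fun m => h.inner m) x) (extChartAt 𝓘(ℝ, E) x x) u v w =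
      k • (chartMetric (fun m => h.inner m) x (extChartAt 𝓘(ℝ, E) x x) v w • u -
        chartMetric (fun m => h.inner m) x (extChartAt 𝓘(ℝ, E) x x) u w • v) := by
  have hm := isMetricAt_chartMetric h x
  have hp (v : E) (hv : v ≠ 0) := chartMetric_self_pos h x hv
  refine hm.coordRiemann_of_sectional_eq (fun v w => ?_) u v w
  by_cases hvw : LinearIndependent ℝ ![v, w]
  · have hs : chartMetric (fun m => h.inner m) x (extChartAt 𝓘(ℝ, E) x x)
        (coordRiemann (chartMetric (fun m => h.inner m) x) (extChartAt 𝓘(ℝ, E) x x) v w w) v /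
        (chartMetric (fun m => h.inner m) x (extChartAt 𝓘(ℝ, E) x x) v v *
          chartMetric (fun m => h.inner m) x (extChartAt 𝓘(ℝ, E) x x) w w -
          chartMetric (fun m => h.inner m) x (extChartAt 𝓘(ℝ, E) x x) v w ^ 2) = k := by
      rw [chartMetric_self, chartMetric_self, chartMetric_self, chartMetric_self]
      exact hk x v w hvw
    rwa [div_eq_iff (gram_pos hm.symm_apply hp hvw).ne'] at hs
  -- The curvature hypothesis is silent on dependent pairs, but for them both sides vanish.
  · rw [LinearIndependent.pair_iff] at hvw
    push Not at hvw
    obtain ⟨s, t, hst, h0⟩ := hvw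
    have hR (v : E) : coordRiemann (chartMetric (fun m => h.inner m) x)
        (extChartAt 𝓘(ℝ, E) x x) v v = 0 := by
      ext w
      have h2 := add_eq_zero_iff_eq_neg.2 (coordRiemann_antisymm
        (chartMetric (fun m => h.inner m) x) (extChartAt 𝓘(ℝ, E) x x) v v w)
      rw [← two_smul ℝ] at h2
      exact (smul_eq_zero.1 h2).resolve_left two_ne_zero
    by_cases hs : s = 0
    · have hw : w = 0 := by
        simpa [hs, h0 hs] using hst
      simp [hw]
    · have hv : v = (-t / s) • w := by
        have : v = s⁻¹ • (s • v + t • w) + (-t / s) • w := by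
          match_scalars <;> field_simp; ring
        rw [hst] at this
        simpa using this
      rw [hv]
      simp only [map_smul, smul_apply, hR, zero_apply, smul_zero, map_zero, smul_eq_mul]
      ring

end Manifold

/-! ### The preferred chart of an open subset of the line. -/

section Opens

variable {J : TopologicalSpace.Opens ℝ}

/-- The chart of `J` is the inclusion into `ℝ`, defined everywhere. The time coordinate is therefore
`t` itself. -/
theorem mem_extChartAt_opens_source (t s : J) : s ∈ (extChartAt 𝓘(ℝ, ℝ) t).source := by
  rw [extChartAt_source, TopologicalSpace.Opens.chartAt_eq,
    OpenPartialHomeomorph.subtypeRestr_source]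
  exact Set.mem_univ _

theorem extChartAt_opens_symm_apply (t : J) {s : ℝ} (hs : s ∈ J) :
    (extChartAt 𝓘(ℝ, ℝ) t).symm s = ⟨s, hs⟩ :=
  (extChartAt 𝓘(ℝ, ℝ) t).left_inv (mem_extChartAt_opens_source t ⟨s, hs⟩)

theorem mem_extChartAt_opens_target (t : J) {s : ℝ} (hs : s ∈ J) :
    s ∈ (extChartAt 𝓘(ℝ, ℝ) t).target :=
  (extChartAt 𝓘(ℝ, ℝ) t).map_source (mem_extChartAt_opens_source t ⟨s, hs⟩)

theorem mdifferentiableAt_extChartAt_symm {E : Type*} [NormedAddCommGroup E] [NormedSpace ℝ E]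
    {M : Type*} [TopologicalSpace M] [ChartedSpace E M] [IsManifold 𝓘(ℝ, E) 1 M] (x : M) {y : E}
    (hy : y ∈ (extChartAt 𝓘(ℝ, E) x).target) :
    MDifferentiableAt 𝓘(ℝ, E) 𝓘(ℝ, E) (extChartAt 𝓘(ℝ, E) x).symm y := by
  have h := mdifferentiableWithinAt_extChartAt_symm (I := 𝓘(ℝ, E)) hy
  rwa [modelWithCornersSelf_coe, Set.range_id, mdifferentiableWithinAt_univ] at h

theorem hasMFDerivAt_extChartAt_opens_symm (t : J) {s : ℝ} (hs : s ∈ J) :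
    HasMFDerivAt 𝓘(ℝ, ℝ) 𝓘(ℝ, ℝ) (extChartAt 𝓘(ℝ, ℝ) t).symm s (ContinuousLinearMap.id ℝ ℝ) := by
  refine ⟨(mdifferentiableAt_extChartAt_symm t (mem_extChartAt_opens_target t hs)).continuousAt, ?_⟩
  have hev : writtenInExtChartAt 𝓘(ℝ, ℝ) 𝓘(ℝ, ℝ) s (extChartAt 𝓘(ℝ, ℝ) t).symm =ᶠ[𝓝 s] id := by
    filter_upwards [J.isOpen.mem_nhds hs] with r hr
    exact congrArg Subtype.val (extChartAt_opens_symm_apply t hr)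
  exact ((hasFDerivAt_id s).congr_of_eventuallyEq hev).hasFDerivWithinAt

end Opens

/-! ### Curvature of FLRW spacetimes. -/

namespace FLRWData

variable {S : Type*} [TopologicalSpace S] [ChartedSpace (EuclideanSpace ℝ (Fin 3)) S]
  [IsManifold 𝓘(ℝ, EuclideanSpace ℝ (Fin 3)) ∞ S]

/-- The spatial metric in the preferred chart at `s`. -/
def spatial (F : FLRWData S) (s : S) : EuclideanSpace ℝ (Fin 3) →
    EuclideanSpace ℝ (Fin 3) →L[ℝ] EuclideanSpace ℝ (Fin 3) →L[ℝ] ℝ :=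
  chartMetric (fun m => F.h.inner m) s

/-- The chart is a product, and its inverse has derivative the identity in time times the derivative
of the spatial inverse chart. -/
theorem chartMetric_metric (F : FLRWData S) (q : F.J × S) {t : ℝ} (ht : t ∈ F.J)
    {y : EuclideanSpace ℝ (Fin 3)}
    (hy : y ∈ (extChartAt 𝓘(ℝ, EuclideanSpace ℝ (Fin 3)) q.2).target) :
    chartMetric F.metric q (t, y) = warped F.a (F.spatial q.2) (t, y) := by
  have : IsManifold 𝓘(ℝ, EuclideanSpace ℝ (Fin 3)) 1 S := IsManifold.of_le (n := ∞) (by simp)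
  have hsymm : ((extChartAt model q).symm : ℝ × EuclideanSpace ℝ (Fin 3) → F.J × S) =
      Prod.map (extChartAt 𝓘(ℝ, ℝ) q.1).symm
        (extChartAt 𝓘(ℝ, EuclideanSpace ℝ (Fin 3)) q.2).symm := by
    rw [extChartAt_prod]; rfl
  have hd : HasMFDerivAt 𝓘(ℝ, ℝ × EuclideanSpace ℝ (Fin 3)) model (extChartAt model q).symm (t, y)
      ((ContinuousLinearMap.id ℝ ℝ).prodMap
        (mfderiv 𝓘(ℝ, EuclideanSpace ℝ (Fin 3)) 𝓘(ℝ, EuclideanSpace ℝ (Fin 3))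
          (extChartAt 𝓘(ℝ, EuclideanSpace ℝ (Fin 3)) q.2).symm y)) := by
    rw [hsymm]
    have h := HasMFDerivAt.prodMap (p := (t, y)) (hasMFDerivAt_extChartAt_opens_symm q.1 ht)
      (mdifferentiableAt_extChartAt_symm q.2 hy).hasMFDerivAt
    rw [(hasMFDerivAt_extChartAt_opens_symm q.1 ht).mfderiv] at h
    exact ⟨h.1, h.2⟩
  have hq : (extChartAt model q).symm (t, y) =
      (⟨t, ht⟩, (extChartAt 𝓘(ℝ, EuclideanSpace ℝ (Fin 3)) q.2).symm y) := by
    rw [hsymm]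
    exact Prod.ext (extChartAt_opens_symm_apply q.1 ht) rfl
  have aux : ∀ q' r : F.J × S, q' = r → ∀ V W : ℝ × EuclideanSpace ℝ (Fin 3),
      (F.metric q' V W : ℝ) = F.metric r V W := by
    rintro _ _ rfl _ _; rfl
  refine ContinuousLinearMap.ext fun V => ContinuousLinearMap.ext fun W => ?_
  rw [chartMetric_apply, hd.mfderiv]
  exact aux _ _ hq _ _

theorem chartMetric_metric_eventuallyEq (F : FLRWData S) (q : F.J × S) :
    chartMetric F.metric q =ᶠ[𝓝 ((q.1 : ℝ), extChartAt 𝓘(ℝ, EuclideanSpace ℝ (Fin 3)) q.2 q.2)]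
      warped F.a (F.spatial q.2) := by
  have ho : IsOpen (extChartAt 𝓘(ℝ, EuclideanSpace ℝ (Fin 3)) q.2).target :=
    isOpen_extChartAt_target q.2
  rw [nhds_prod_eq]
  filter_upwards [Filter.prod_mem_prod (F.J.isOpen.mem_nhds q.1.2)
    (ho.mem_nhds (mem_extChartAt_target q.2))] with p hp
  exact F.chartMetric_metric q hp.1 hp.2

theorem eventually_contDiffAt (F : FLRWData S) (t : F.J) :
    ∀ᶠ s in 𝓝 (t : ℝ), ContDiffAt ℝ ∞ F.a s := by
  filter_upwards [F.J.isOpen.mem_nhds t.2] with s hs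
  exact F.a_smooth.contDiffAt (F.J.isOpen.mem_nhds hs)

/-- The spatial part `a(t)² h` of the spacetime metric. -/
def space (F : FLRWData S) (q : F.J × S) :
    EuclideanSpace ℝ (Fin 3) →L[ℝ] EuclideanSpace ℝ (Fin 3) →L[ℝ] ℝ :=
  F.a q.1 ^ 2 • (F.h.inner q.2 :
    EuclideanSpace ℝ (Fin 3) →L[ℝ] EuclideanSpace ℝ (Fin 3) →L[ℝ] ℝ)

theorem space_symm (F : FLRWData S) (q : F.J × S) (v w : EuclideanSpace ℝ (Fin 3)) :
    F.space q v w = F.space q w v :=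
  congrArg (F.a q.1 ^ 2 * ·) (F.h.symm q.2 v w)

theorem space_pos (F : FLRWData S) (q : F.J × S) (v : EuclideanSpace ℝ (Fin 3)) (hv : v ≠ 0) :
    0 < F.space q v v :=
  mul_pos (pow_pos (F.a_pos _ q.1.2) 2) (F.h.pos q.2 v hv)

theorem metric_eq (F : FLRWData S) (q : F.J × S) (V W : ℝ × EuclideanSpace ℝ (Fin 3)) :
    F.metric q V W = -(V.1 * W.1) + F.space q V.2 W.2 := rfl

theorem spatial_eq (F : FLRWData S) (q : F.J × S) (v w : EuclideanSpace ℝ (Fin 3)) :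
    F.spatial q.2 (extChartAt 𝓘(ℝ, EuclideanSpace ℝ (Fin 3)) q.2 q.2) v w =
      F.space q v w / F.a q.1 ^ 2 := by
  rw [eq_div_iff (pow_ne_zero 2 (F.a_pos _ q.1.2).ne'), mul_comm]
  exact congrArg (F.a q.1 ^ 2 * ·) (chartMetric_self (fun m => F.h.inner m) q.2 v w)

/-- The sectional curvature of the planes containing `∂_t`. -/
def radialCurvature (F : FLRWData S) (q : F.J × S) : ℝ :=
  deriv (deriv F.a) q.1 / F.a q.1

/-- The sectional curvature of the planes tangent to the spatial slices. -/
def spaceCurvature (F : FLRWData S) (q : F.J × S) : ℝ :=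
  (F.k + deriv F.a q.1 ^ 2) / F.a q.1 ^ 2

theorem riemann_eq (F : FLRWData S) (q : F.J × S) (U V W : ℝ × EuclideanSpace ℝ (Fin 3)) :
    (riemann F.metric q U V W : ℝ × EuclideanSpace ℝ (Fin 3)) =
      (F.radialCurvature q * (U.1 * F.space q V.2 W.2 - V.1 * F.space q U.2 W.2),
        (F.radialCurvature q * W.1) • (U.1 • V.2 - V.1 • U.2) +
          F.spaceCurvature q • (F.space q V.2 W.2 • U.2 - F.space q U.2 W.2 • V.2)) := by
  have h0 := (F.a_pos _ q.1.2).ne'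
  change coordRiemann (chartMetric F.metric q)
    ((q.1 : ℝ), extChartAt 𝓘(ℝ, EuclideanSpace ℝ (Fin 3)) q.2 q.2) U V W = _
  rw [coordRiemann_congr (F.chartMetric_metric_eventuallyEq q),
    coordRiemann_warped (H := F.spatial q.2) (F.eventually_contDiffAt q.1) h0
      (isMetricAt_chartMetric F.h q.2)]
  have hk := coordRiemann_of_hasConstantCurvature F.h F.constantCurvature q.2 U.2 V.2 W.2
  change coordRiemann (F.spatial q.2) _ U.2 V.2 W.2 =
    F.k • (F.spatial q.2 _ V.2 W.2 • U.2 - F.spatial q.2 _ U.2 W.2 • V.2) at hk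
  rw [hk]
  simp only [spatial_eq, radialCurvature, spaceCurvature]
  refine Prod.ext ?_ ?_
  · simp only
    field_simp
  · simp only
    match_scalars <;> field_simp <;> ring

theorem ricci_eq (F : FLRWData S) (q : F.J × S) (V W : ℝ × EuclideanSpace ℝ (Fin 3)) :
    ricci F.metric q V W = -3 * F.radialCurvature q * (V.1 * W.1) +
      (F.radialCurvature q + 2 * F.spaceCurvature q) * F.space q V.2 W.2 := by
  have h0 := (F.a_pos _ q.1.2).ne'
  change coordRicci (chartMetric F.metric q)
    ((q.1 : ℝ), extChartAt 𝓘(ℝ, EuclideanSpace ℝ (Fin 3)) q.2 q.2) V W = _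
  rw [coordRicci_congr (F.chartMetric_metric_eventuallyEq q),
    coordRicci_warped (H := F.spatial q.2) (by simp) (F.eventually_contDiffAt q.1) h0
      (isMetricAt_chartMetric F.h q.2)
      (coordRiemann_of_hasConstantCurvature F.h F.constantCurvature q.2)]
  simp only [spatial_eq, radialCurvature, spaceCurvature]
  field_simp

theorem scalar_eq (F : FLRWData S) (q : F.J × S) :
    scalar F.metric q = 6 * (F.radialCurvature q + F.spaceCurvature q) := by
  have h0 := (F.a_pos _ q.1.2).ne'
  change coordScalar (chartMetric F.metric q)
    ((q.1 : ℝ), extChartAt 𝓘(ℝ, EuclideanSpace ℝ (Fin 3)) q.2 q.2) = _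
  rw [coordScalar_congr (F.chartMetric_metric_eventuallyEq q),
    coordScalar_warped (H := F.spatial q.2) (by simp) (F.eventually_contDiffAt q.1) h0
      (isMetricAt_chartMetric F.h q.2)
      (coordRiemann_of_hasConstantCurvature F.h F.constantCurvature q.2)]
  rfl

/-- Orthonormality expresses the spatial products through the time components, making the Gram
determinant `U.1 ^ 2 - V.1 ^ 2 - 1`. It vanishes exactly for planes containing `∂_t`. -/
theorem sectional_eq (F : FLRWData S) (q : F.J × S) (U V : ℝ × EuclideanSpace ℝ (Fin 3))
    (hU : F.metric q U U = -1) (hV : F.metric q V V = 1) (hUV : F.metric q U V = 0) :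
    sectional F.metric q U V = F.radialCurvature q +
      (F.radialCurvature q - F.spaceCurvature q) *
        (F.space q U.2 U.2 * F.space q V.2 V.2 - F.space q U.2 V.2 ^ 2) := by
  have hs : sectional F.metric q U V = F.metric q (riemann F.metric q U V V) U /
    (F.metric q U U * F.metric q V V - F.metric q U V ^ 2) := rfl
  rw [hs, hU, hV, hUV, F.metric_eq q (riemann F.metric q U V V) U, riemann_eq]
  rw [metric_eq] at hU hV hUV
  simp only [map_add, map_sub, map_smul, add_apply, sub_apply, smul_apply, smul_eq_mul,
    F.space_symm q V.2 U.2]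
  have hUU : F.space q U.2 U.2 = U.1 * U.1 - 1 := by linarith
  have hVV : F.space q V.2 V.2 = V.1 * V.1 + 1 := by linarith
  have hUV' : F.space q U.2 V.2 = U.1 * V.1 := by linarith
  rw [hUU, hVV, hUV']
  ring

theorem exists_orthonormal (F : FLRWData S) (q : F.J × S) :
    ∃ e f : EuclideanSpace ℝ (Fin 3),
      F.space q e e = 1 ∧ F.space q f f = 1 ∧ F.space q e f = 0 := by
  have normalize (v : EuclideanSpace ℝ (Fin 3)) (hv : v ≠ 0) :
      F.space q ((√(F.space q v v))⁻¹ • v) ((√(F.space q v v))⁻¹ • v) = 1 := by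
    have h := F.space_pos q v hv
    simp only [map_smul, smul_apply, smul_eq_mul]
    have := Real.mul_self_sqrt h.le
    have h' := (Real.sqrt_pos.2 h).ne'
    field_simp
    linarith
  obtain ⟨v, hv⟩ := exists_ne (0 : EuclideanSpace ℝ (Fin 3))
  obtain ⟨w, hvw⟩ := exists_linearIndependent_pair_of_one_lt_finrank (R := ℝ)
    (M := EuclideanSpace ℝ (Fin 3)) (by simp) hv
  -- Gram–Schmidt without division: this vector is orthogonal to `v`.
  have hx : F.space q v v • w - F.space q v w • v ≠ 0 := by
    intro h
    have := (LinearIndependent.pair_iff.1 hvw) (-F.space q v w) (F.space q v v)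
      (by rw [← h]; module)
    exact (F.space_pos q v hv).ne' this.2
  refine ⟨_, _, normalize v hv, normalize _ hx, ?_⟩
  simp only [map_smul, map_sub, smul_apply, smul_eq_mul]
  ring

/-! ### Curvature signs, energy conditions and the fluid as inequalities and equations in the two
curvatures. -/

theorem timelikeSectionalNonpos_iff (F : FLRWData S) :
    TimelikeSectionalNonpos F.metric ↔
      ∀ q, F.radialCurvature q ≤ 0 ∧ F.radialCurvature q ≤ F.spaceCurvature q := by
  constructor
  · intro h q
    obtain ⟨e, f, he, hf, hef⟩ := F.exists_orthonormal q
    have key (s : ℝ) : F.radialCurvature q +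
        (F.radialCurvature q - F.spaceCurvature q) * s ^ 2 ≤ 0 := by
      -- An observer boosted along `e`, paired with the transverse direction `f`. The spatial Gram
      -- determinant is `s ^ 2`.
      let U : ℝ × EuclideanSpace ℝ (Fin 3) := (√(1 + s ^ 2), s • e)
      let V : ℝ × EuclideanSpace ℝ (Fin 3) := (0, f)
      have hU : F.metric q U U = -1 := by
        have := Real.mul_self_sqrt (by positivity : 0 ≤ 1 + s ^ 2)
        simp only [metric_eq, U, map_smul, smul_apply, smul_eq_mul, he]
        linarith
      have hV : F.metric q V V = 1 := by simp [metric_eq, V, hf]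
      have hUV : F.metric q U V = 0 := by simp [metric_eq, U, V, hef]
      have h1 := h q U V hU hV hUV
      rw [F.sectional_eq q U V hU hV hUV] at h1
      simp only [U, V, map_smul, smul_apply, smul_eq_mul, he, hf, hef] at h1
      linarith
    have h0 : F.radialCurvature q ≤ 0 := by simpa using key 0
    refine ⟨h0, le_of_not_gt fun hlt => ?_⟩
    have hd : 0 < F.radialCurvature q - F.spaceCurvature q := by linarith
    have hr : 0 ≤ (1 - F.radialCurvature q) / (F.radialCurvature q - F.spaceCurvature q) :=
      div_nonneg (by linarith) hd.le
    -- This boost makes the sectional curvature equal to 1.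
    have := key √((1 - F.radialCurvature q) / (F.radialCurvature q - F.spaceCurvature q))
    rw [Real.sq_sqrt hr, mul_div_cancel₀ _ hd.ne'] at this
    linarith
  · intro h q U V hU hV hUV
    rw [F.sectional_eq q U V hU hV hUV]
    nlinarith [h q, mul_nonneg (sub_nonneg.2 (h q).2)
      (gram_nonneg (F.space_symm q) (F.space_pos q) (Prod.snd U) (Prod.snd V))]

theorem timelikeSectionalNeg_of_lt (F : FLRWData S)
    (h : ∀ q, F.radialCurvature q < 0 ∧ F.radialCurvature q ≤ F.spaceCurvature q) :
    TimelikeSectionalNeg F.metric := by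
  intro q U V hU hV hUV
  rw [F.sectional_eq q U V hU hV hUV]
  nlinarith [h q, mul_nonneg (sub_nonneg.2 (h q).2)
    (gram_nonneg (F.space_symm q) (F.space_pos q) (Prod.snd U) (Prod.snd V))]

theorem strongEnergyCondition_iff (F : FLRWData S) :
    StrongEnergyCondition F.metric ↔
      ∀ q, F.radialCurvature q ≤ 0 ∧ F.radialCurvature q ≤ F.spaceCurvature q := by
  constructor
  · intro h q
    obtain ⟨e, -, he, -, -⟩ := F.exists_orthonormal q
    have key (r : ℝ) (hr : 0 ≤ r) (hr1 : r < 1) : 0 ≤ -3 * F.radialCurvature q +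
        (F.radialCurvature q + 2 * F.spaceCurvature q) * r := by
      let X : ℝ × EuclideanSpace ℝ (Fin 3) := (1, √r • e)
      have hX : F.space q (√r • e) (√r • e) = r := by
        simp [he, Real.mul_self_sqrt hr]
      have h1 : F.metric q X X < 0 := by
        rw [metric_eq, hX]
        linarith
      have h2 := h q X h1
      rw [ricci_eq, hX] at h2
      linarith
    have h0 : F.radialCurvature q ≤ 0 := by linarith [key 0 le_rfl one_pos]
    refine ⟨h0, ?_⟩
    -- At `r = 1` the vector is null, so the condition does not apply to it. The endpoint inequality
    -- is reached as a limit of timelike vectors.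
    have hlim : Filter.Tendsto (fun r : ℝ => -3 * F.radialCurvature q +
        (F.radialCurvature q + 2 * F.spaceCurvature q) * r) (𝓝[<] 1)
        (𝓝 (-3 * F.radialCurvature q +
          (F.radialCurvature q + 2 * F.spaceCurvature q) * 1)) :=
      (Continuous.tendsto (by fun_prop) 1).mono_left nhdsWithin_le_nhds
    have := ge_of_tendsto hlim (Filter.mem_of_superset
      (Ioo_mem_nhdsLT zero_lt_one) fun r hr => key r hr.1.le hr.2)
    linarith
  · intro h q X hX
    have hX' := F.metric_eq q X X
    rw [hX'] at hX
    have hr := F.ricci_eq q X X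
    rw [hr]
    have h0 : 0 ≤ F.space q (Prod.snd X) (Prod.snd X) := by
      by_cases h0 : Prod.snd X = 0
      · rw [h0]; simp
      · exact (F.space_pos q _ h0).le
    -- With N the spatial square of X and τ its time component, Ric(X, X) = -3A(τ² - N) + 2(B - A)N,
    -- a sum of nonnegative terms.
    nlinarith [mul_nonneg (sub_nonneg.2 (h q).2) h0,
      mul_nonneg (neg_nonneg.2 (h q).1) (neg_pos.2 hX).le]

/-- Both sides are combinations of dt² and the spatial metric. One evaluation on `∂_t` and one on a
spatial unit vector therefore capture the whole tensor equation. -/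
theorem einsteinPerfectFluid_iff (F : FLRWData S) (ρ p : F.J × S → ℝ) :
    EinsteinPerfectFluid F.metric F.comoving ρ p ↔
      ∀ q, 8 * Real.pi * ρ q = 3 * F.spaceCurvature q ∧
        8 * Real.pi * p q = -2 * F.radialCurvature q - F.spaceCurvature q := by
  have hu (q : F.J × S) (X : ℝ × EuclideanSpace ℝ (Fin 3)) :
      F.metric q (F.comoving q) X = -X.1 := by
    refine (F.metric_eq q (1, 0) X).trans ?_
    simp
  constructor
  · intro h q
    obtain ⟨e, -, he, -, -⟩ := F.exists_orthonormal q
    have h1 := h q ((1, 0) : ℝ × EuclideanSpace ℝ (Fin 3)) ((1, 0) : ℝ × EuclideanSpace ℝ (Fin 3))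
    have h2 := h q ((0, e) : ℝ × EuclideanSpace ℝ (Fin 3)) ((0, e) : ℝ × EuclideanSpace ℝ (Fin 3))
    rw [ricci_eq, scalar_eq, hu, metric_eq] at h1 h2
    simp only [map_zero, he] at h1 h2
    exact ⟨by linarith, by linarith⟩
  · intro h q X Y
    have hX := hu q X
    have hY := hu q Y
    have hXY := F.metric_eq q X Y
    have hr := F.ricci_eq q X Y
    rw [hr, scalar_eq, hX, hY, hXY]
    linear_combination (Prod.fst X * Prod.fst Y) * (h q).1 * (-1) -
      F.space q (Prod.snd X) (Prod.snd Y) * (h q).2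

end FLRWData

end FLRW

end

theorem mainTheorem4 {S : Type*} [TopologicalSpace S]
    [ChartedSpace (EuclideanSpace ℝ (Fin 3)) S]
    [IsManifold 𝓘(ℝ, EuclideanSpace ℝ (Fin 3)) ∞ S] (F : FLRW.FLRWData S) :
    (∃ ρ p : F.J × S → ℝ, FLRW.EinsteinPerfectFluid F.metric F.comoving ρ p) ∧
    (FLRW.TimelikeSectionalNonpos F.metric ↔ FLRW.StrongEnergyCondition F.metric) ∧
    ∀ ρ p : F.J × S → ℝ, FLRW.EinsteinPerfectFluid F.metric F.comoving ρ p →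
      (FLRW.TimelikeSectionalNonpos F.metric ↔ ∀ q, 0 ≤ ρ q + p q ∧ 0 ≤ ρ q + 3 * p q) ∧
      ((∀ q, 0 ≤ ρ q + p q ∧ 0 ≤ ρ q + 3 * p q) ↔ FLRW.StrongEnergyCondition F.metric) ∧
      ((∀ q, 0 < ρ q ∧ 0 ≤ p q) → FLRW.TimelikeSectionalNeg F.metric) := by
  have hpi : 0 < 8 * Real.pi := by positivity
  rw [F.timelikeSectionalNonpos_iff, F.strongEnergyCondition_iff]
  refine ⟨⟨fun q => 3 * F.spaceCurvature q / (8 * Real.pi),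
    fun q => (-2 * F.radialCurvature q - F.spaceCurvature q) / (8 * Real.pi),
    (F.einsteinPerfectFluid_iff _ _).2 fun q =>
      ⟨mul_div_cancel₀ _ hpi.ne', mul_div_cancel₀ _ hpi.ne'⟩⟩, Iff.rfl, fun ρ p h => ?_⟩
  rw [F.einsteinPerfectFluid_iff] at h
  have hsum (q) : 8 * Real.pi * (ρ q + p q) =
      2 * (F.spaceCurvature q - F.radialCurvature q) := by linarith [h q]
  have hsum3 (q) : 8 * Real.pi * (ρ q + 3 * p q) = -6 * F.radialCurvature q := by linarith [h q]
  have hiff : (∀ q, F.radialCurvature q ≤ 0 ∧ F.radialCurvature q ≤ F.spaceCurvature q) ↔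
      ∀ q, 0 ≤ ρ q + p q ∧ 0 ≤ ρ q + 3 * p q := by
    refine forall_congr' fun q => ?_
    rw [← mul_nonneg_iff_of_pos_left hpi, hsum,
      ← mul_nonneg_iff_of_pos_left (b := ρ q + 3 * p q) hpi, hsum3]
    constructor <;> rintro ⟨h1, h2⟩ <;> constructor <;> linarith
  refine ⟨hiff, hiff.symm, fun hpos => F.timelikeSectionalNeg_of_lt fun q => ?_⟩
  -- Strictness of the conclusion comes from ρ + 3p > 0, which makes the radial curvature negative.
  -- From ρ + p only the weak inequality is needed.
  have h1 := mul_pos hpi (by linarith [hpos q] : 0 < ρ q + p q)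
  have h3 := mul_pos hpi (by linarith [hpos q] : 0 < ρ q + 3 * p q)
  rw [hsum] at h1
  rw [hsum3] at h3
  constructor <;> linarith
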